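/- For every $c>0$ there is a constant $p>0$, depending only on $c$, such that the following holds. Let $d\ge 1$, $\mu,L>0$, $\epsilon\in(0,1)$, and let $f:\mathbb R^d\to\mathbb R$ be a differentiable function with $$\mu\le\frac{f(y)-f(x)-\langle\nabla f(x),y-x\rangle}{\|x-y\|^2/2}\le L\qquad\text{for all }x\ne y$$ (that is, $f$ is $\mu$-strongly convex and $L$-smooth), attaining its minimum at the origin. Let $M\ge1$ and let $\sigma_1,\dots,\sigma_M$ satisfy $$\sigma_1^2=\frac{\epsilon}{2dL},\qquad \sigma_{i+1}^2=\Bigl(1+\frac1{\sqrt d}\Bigr)\sigma_i^2\ (1\le i<M),\qquad \sigma_M^2\ge c\,\frac{\sqrt d}{\mu}.$$ Let $f_0(x)=\frac{\|x\|^2}{2\sigma_1^2}$, let $f_i(x)=f(x)+\frac{\|x\|^2}{2\sigma_i^2}$ for $1\le i\le M$, and let $f_{M+1}=f$. Let $\pi_0(x)=(2\pi\sigma_1^2)^{-d/2}e^{-f_0(x)}$ be the Gaussian density and, for $1\le i\le M+1$, let $\pi_i(x)=Z_i^{-1}e^{-f_i(x)}$ with $Z_i=\int_{\mathbb R^d}e^{-f_i(x)}\,dx$.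 Let $|\pi_i\rangle=\int_{\mathbb R^d}\sqrt{\pi_i(x)}\,|x\rangle\,dx$ be the qsample state, i.e. the vector $\sqrt{\pi_i}$ of $L^2(\mathbb R^d;\mathbb C)$. Then $$|\langle\pi_i|\pi_{i+1}\rangle|\ge p\qquad\text{for all }0\le i\le M.$$ -/

import Mathlib

open MeasureTheory

noncomputable section

/-- `f` is differentiable and, for all `x ≠ y`,
`(f y - f x - ⟪∇f x, y - x⟫) / (‖x - y‖² / 2) ∈ [μ, L]`, i.e. `f` is `L`-smooth and
`μ`-strongly convex. -/
def IsSmoothStronglyConvex {d : ℕ} (μ L : ℝ) (f : EuclideanSpace ℝ (Fin d) → ℝ) : Prop :=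
  Differentiable ℝ f ∧
    ∀ x y : EuclideanSpace ℝ (Fin d), x ≠ y →
      (f y - f x - inner ℝ (gradient f x) (y - x)) / (‖x - y‖ ^ 2 / 2) ∈ Set.Icc μ L

/-- The potentials `f₀ = ‖x‖²/(2σ₁²)`, `f_i = f + ‖x‖²/(2σ_i²)` for `1 ≤ i ≤ M`, and
`f_i = f` for `i > M` (only `i = M + 1` is used). -/
def annealPotential {d : ℕ} (f : EuclideanSpace ℝ (Fin d) → ℝ) (σ : ℕ → ℝ) (M i : ℕ)
    (x : EuclideanSpace ℝ (Fin d)) : ℝ :=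
  if i = 0 then ‖x‖ ^ 2 / (2 * σ 1 ^ 2)
  else if i ≤ M then f x + ‖x‖ ^ 2 / (2 * σ i ^ 2)
  else f x

/-- The densities with respect to Lebesgue measure: the Gaussian density
`π₀ = (2πσ₁²)^(-d/2) exp(-f₀)`, and `π_i = Z_i⁻¹ exp(-f_i)` with `Z_i = ∫ exp(-f_i)`
for `i ≥ 1`. -/
def annealDensity {d : ℕ} (f : EuclideanSpace ℝ (Fin d) → ℝ) (σ : ℕ → ℝ) (M i : ℕ)
    (x : EuclideanSpace ℝ (Fin d)) : ℝ :=
  if i = 0 then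
    (2 * Real.pi * σ 1 ^ 2) ^ (-(d : ℝ) / 2) * Real.exp (-annealPotential f σ M 0 x)
  else
    (∫ y, Real.exp (-annealPotential f σ M i y))⁻¹ * Real.exp (-annealPotential f σ M i x)

open Classical in
/-- The qsample state `∫ √(ρ x) |x⟩ dx` of a density `ρ` on `ℝᵈ`: the element of
`L²(ℝᵈ; ℂ)` given by the function `√ρ`. (If `√ρ` is not square integrable, the value is `0`,
whose overlap with every state is `0`.) -/
def qsample {d : ℕ} (ρ : EuclideanSpace ℝ (Fin d) → ℝ) :
    Lp ℂ 2 (volume : Measure (EuclideanSpace ℝ (Fin d))) :=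
  if h : MemLp (fun x => ((Real.sqrt (ρ x) : ℝ) : ℂ)) 2 volume then h.toLp _ else 0

end

/-! Write Z(t) = ∫ exp(-(f + t‖x‖²/2)). For confinement strengths b ≤ a the overlap of two qsamples
is Z((a+b)/2) / √(Z(a)Z(b)), so approximate midpoint log-concavity of Z is needed. It comes from
Prékopa–Leindler, used with a contracted midpoint α(x+y), α ≤ 1/2. Put A = a+μ, B = b+μ. The convex
function f - μ‖·‖²/2 is minimal at 0, so contraction costs it nothing; the remaining quadratic parts
allow α = √(AB)/(A+B). The only loss is the Jacobian (2α)^d = (1 + (A-B)²/(4AB))^(-d/2), which is at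
least exp(-K/8) when d(a-b)² ≤ K B².

Interior steps have a - b = b/√d, so K = 1; the last step has b = 0 and a = 1/σ_M² ≤ μ/(c√d), so K =
1/c². The first step compares a Gaussian with its perturbation by f, using f(0) ≤ f ≤ f(0) + L‖x‖²/2
and explicit Gaussian integrals. -/

open scoped ENNReal

/-! ### Brunn–Minkowski and Prékopa–Leindler inequalities -/

/-- The one-dimensional Brunn–Minkowski inequality for compact sets. -/
theorem volume_add_volume_le_of_isCompact {K L C : Set ℝ} (hK : IsCompact K) (hL : IsCompact L)
    (hK' : K.Nonempty) (hL' : L.Nonempty) (h : ∀ x ∈ K, ∀ y ∈ L, x + y ∈ C) :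
    volume K + volume L ≤ volume C := by
  obtain ⟨k, hk, hkmax⟩ := hK.exists_isGreatest hK'
  obtain ⟨l, hl, hlmin⟩ := hL.exists_isLeast hL'
  have hA : volume ((fun x => x + l) '' K) = volume K := by
    simp [Set.image_add_right]
  have hB : volume ((fun y => k + y) '' L) = volume L := by
    simp [Set.image_add_left]
  have hBm : MeasurableSet ((fun y => k + y) '' L) :=
    (hL.image (by fun_prop)).measurableSet
  have hdisj : AEDisjoint volume ((fun x => x + l) '' K) ((fun y => k + y) '' L) := by
    -- As k is the maximum of K and l the minimum of L, the translates K + l and k + L can meet only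
    -- at k + l.
    refine measure_mono_null (t := {k + l}) ?_ (by simp)
    rintro z ⟨⟨x, hx, rfl⟩, ⟨y, hy, hxy⟩⟩
    have h1 := hkmax hx
    have h2 := hlmin hy
    simp only [Set.mem_singleton_iff] at *
    linarith
  rw [← hA, ← hB, ← measure_union₀ hBm.nullMeasurableSet hdisj]
  refine measure_mono ?_
  rintro z (⟨x, hx, rfl⟩ | ⟨y, hy, rfl⟩)
  · exact h x hx l hl
  · exact h k hk y hy

/-- The one-dimensional Brunn–Minkowski inequality. -/
theorem volume_add_volume_le {A B C : Set ℝ} (hA : MeasurableSet A) (hB : MeasurableSet B)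
    (hA' : A.Nonempty) (hB' : B.Nonempty) (h : ∀ x ∈ A, ∀ y ∈ B, x + y ∈ C) :
    volume A + volume B ≤ volume C := by
  obtain ⟨a, ha⟩ := hA'
  obtain ⟨b, hb⟩ := hB'
  rw [hA.measure_eq_iSup_isCompact, hB.measure_eq_iSup_isCompact]
  simp_rw [iSup_and']
  refine ENNReal.biSup_add_biSup_le' ⟨∅, by simp⟩ ⟨∅, by simp⟩ ?_
  rintro K ⟨hKA, hK⟩ L ⟨hLB, hL⟩
  -- The approximating compact sets may be empty; adding one point makes them nonempty.
  calc volume K + volume L ≤ volume (insert a K) + volume (insert b L) := by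
        gcongr <;> exact Set.subset_insert _ _
    _ ≤ volume C := by
        refine volume_add_volume_le_of_isCompact (hK.insert a) (hL.insert b)
          (Set.insert_nonempty _ _) (Set.insert_nonempty _ _) fun x hx y hy => h x ?_ y ?_
        · exact Set.insert_subset ha hKA hx
        · exact Set.insert_subset hb hLB hy

/-- The one-dimensional Prékopa–Leindler inequality for functions with supremum `1`, in its
stronger additive form. -/
theorem lintegral_add_lintegral_le_of_sup_eq_one {f g h : ℝ → ℝ} (hf : Measurable f)
    (hg : Measurable g) (hh : Measurable h) (hf0 : 0 ≤ f) (hg0 : 0 ≤ g) (hh0 : 0 ≤ h)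
    (hf1 : ∀ x, f x ≤ 1) (hg1 : ∀ x, g x ≤ 1)
    (hfs : ∀ t < 1, ∃ x, t < f x) (hgs : ∀ t < 1, ∃ x, t < g x)
    (hfgh : ∀ x y, f x * g y ≤ h ((1 / 2 : ℝ) • (x + y)) ^ 2) :
    (∫⁻ x, ENNReal.ofReal (f x)) + ∫⁻ x, ENNReal.ofReal (g x) ≤
      2 * ∫⁻ x, ENNReal.ofReal (h x) := by
  rw [lintegral_eq_lintegral_meas_lt _ (.of_forall hf0) hf.aemeasurable,
    lintegral_eq_lintegral_meas_lt _ (.of_forall hg0) hg.aemeasurable,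
    lintegral_eq_lintegral_meas_lt _ (.of_forall hh0) hh.aemeasurable,
    ← lintegral_const_mul' _ _ (by simp)]
  have hanti : ∀ u : ℝ → ℝ, Measurable fun t : ℝ => volume {a : ℝ | t < u a} := fun u =>
    Antitone.measurable fun s t hst => measure_mono fun a (ha : t < u a) => hst.trans_lt ha
  rw [← lintegral_add_left (hanti f)]
  refine setLIntegral_mono' measurableSet_Ioi fun t ht => ?_
  have ht0 : 0 < t := ht
  -- Brunn–Minkowski needs nonempty level sets. With both suprema equal to 1, they are nonempty for
  -- t < 1 and both empty for t ≥ 1.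
  rcases le_or_gt 1 t with h1 | h1
  · have e1 : {a | t < f a} = ∅ := by ext x; simpa using (hf1 x).trans h1
    have e2 : {a | t < g a} = ∅ := by ext x; simpa using (hg1 x).trans h1
    simp [e1, e2]
  · have key := volume_add_volume_le (C := (fun z => (1 / 2 : ℝ) • z) ⁻¹' {a | t < h a})
      (measurableSet_lt measurable_const hf) (measurableSet_lt measurable_const hg)
      (hfs t h1) (hgs t h1) (by
        intro x hx y hy
        have hx' : t < f x := hx
        have hy' : t < g y := hy
        refine lt_of_pow_lt_pow_left₀ 2 (hh0 _) (lt_of_lt_of_le ?_ (hfgh x y))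
        nlinarith)
    rw [Measure.addHaar_preimage_smul _ (by norm_num)] at key
    simpa using key

/-- The arithmetic-geometric mean inequality for two extended nonnegative reals. -/
theorem ENNReal.four_mul_mul_le_add_sq (x y : ℝ≥0∞) : 4 * (x * y) ≤ (x + y) ^ 2 := by
  rcases eq_or_ne x ⊤ with rfl | hx
  · simp
  rcases eq_or_ne y ⊤ with rfl | hy
  · simp
  lift x to NNReal using hx
  lift y to NNReal using hy
  norm_cast
  rw [← NNReal.coe_le_coe]
  push_cast
  nlinarith [sq_nonneg ((x : ℝ) - y)]

/-- The midpoint Prékopa–Leindler inequality holds on `E`. -/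
def PrekopaLeindler (E : Type*) [AddCommGroup E] [Module ℝ E] [MeasureSpace E] : Prop :=
  ∀ F G H : E → ℝ≥0∞, Measurable F → Measurable G → Measurable H →
    (∀ x y, F x * G y ≤ H ((1 / 2 : ℝ) • (x + y)) ^ 2) →
    (∫⁻ x, F x) * ∫⁻ x, G x ≤ (∫⁻ x, H x) ^ 2

theorem exists_lt_toReal_div_iSup {F : ℝ → ℝ≥0∞} (h0 : (⨆ x, F x) ≠ 0) (htop : (⨆ x, F x) ≠ ⊤)
    {t : ℝ} (ht : t < 1) : ∃ x, t < (F x / ⨆ x, F x).toReal := by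
  rcases lt_or_ge t 0 with h | h
  · exact ⟨0, h.trans_le ENNReal.toReal_nonneg⟩
  have h1 : ENNReal.ofReal t * (⨆ x, F x) < ⨆ x, F x := by
    conv_rhs => rw [← one_mul (⨆ x, F x)]
    exact (ENNReal.mul_lt_mul_iff_left h0 htop).2 (by simpa using ht)
  obtain ⟨x, hx⟩ := lt_iSup_iff.1 h1
  refine ⟨x, ?_⟩
  have hlt : F x / (⨆ x, F x) ≠ ⊤ :=
    ENNReal.div_ne_top (ne_top_of_le_ne_top htop (le_iSup F x)) h0
  rw [← ENNReal.ofReal_lt_iff_lt_toReal h hlt]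
  exact (ENNReal.lt_div_iff_mul_lt (.inl h0) (.inl htop)).2 hx

/-- Dividing F, G, H by α, β, √(αβ) reduces to supremum 1, where the additive form holds; the
arithmetic-geometric mean inequality then turns the sum into a product. -/
theorem lintegral_mul_lintegral_le_of_bounded {F G H : ℝ → ℝ≥0∞} (hF : Measurable F)
    (hG : Measurable G) (hH : Measurable H) (hFt : (⨆ x, F x) ≠ ⊤) (hGt : (⨆ x, G x) ≠ ⊤)
    (h : ∀ x y, F x * G y ≤ H ((1 / 2 : ℝ) • (x + y)) ^ 2) :
    (∫⁻ x, F x) * ∫⁻ x, G x ≤ (∫⁻ x, H x) ^ 2 := by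
  set α := ⨆ x, F x with hα
  set β := ⨆ x, G x with hβ
  rcases eq_or_ne α 0 with hα0 | hα0
  · have : ∀ x, F x = 0 := fun x => le_zero_iff.1 ((le_iSup F x).trans_eq (hα.symm.trans hα0))
    simp [this]
  rcases eq_or_ne β 0 with hβ0 | hβ0
  · have : ∀ x, G x = 0 := fun x => le_zero_iff.1 ((le_iSup G x).trans_eq (hβ.symm.trans hβ0))
    simp [this]
  set γ : ℝ≥0∞ := (α * β) ^ (1 / 2 : ℝ) with hγ
  have hγ2 : γ ^ 2 = α * β := by
    rw [hγ, ← ENNReal.rpow_natCast, ← ENNReal.rpow_mul]; norm_num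
  have hαβ0 : α * β ≠ 0 := mul_ne_zero hα0 hβ0
  have hαβt : α * β ≠ ⊤ := ENNReal.mul_ne_top hFt hGt
  have hFα : ∀ x, F x / α ≤ 1 := fun x => ENNReal.div_le_of_le_mul (by simpa using le_iSup F x)
  have hGβ : ∀ x, G x / β ≤ 1 := fun x => ENNReal.div_le_of_le_mul (by simpa using le_iSup G x)
  have hdiv : ∀ u v w : ℝ≥0∞, u * v ≤ w ^ 2 → u / α * (v / β) ≤ (w / γ) ^ 2 := by
    intro u v w huv
    simp only [div_eq_mul_inv]
    rw [mul_pow, ← ENNReal.inv_pow, hγ2, ENNReal.mul_inv (.inl hα0) (.inl hFt), mul_mul_mul_comm]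
    gcongr
  -- H may be infinite. Capping it at 1 permits real values and keeps the hypothesis, since the
  -- normalized F and G are at most 1.
  have hmin : ∀ x, min (H x / γ) 1 ≠ ⊤ := fun x => by simp
  have key := lintegral_add_lintegral_le_of_sup_eq_one
    (f := fun x => (F x / α).toReal) (g := fun x => (G x / β).toReal)
    (h := fun x => (min (H x / γ) 1).toReal) (by fun_prop) (by fun_prop) (by fun_prop)
    (fun _ => ENNReal.toReal_nonneg) (fun _ => ENNReal.toReal_nonneg)
    (fun _ => ENNReal.toReal_nonneg)
    (fun x => ENNReal.toReal_le_of_le_ofReal zero_le_one (by simpa using hFα x))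
    (fun x => ENNReal.toReal_le_of_le_ofReal zero_le_one (by simpa using hGβ x))
    (fun t ht => exists_lt_toReal_div_iSup hα0 hFt ht)
    (fun t ht => exists_lt_toReal_div_iSup hβ0 hGt ht) (by
      intro x y
      rw [← ENNReal.toReal_mul, ← ENNReal.toReal_pow]
      refine ENNReal.toReal_mono (ENNReal.pow_ne_top (hmin _)) ?_
      rcases le_total (H ((1 / 2 : ℝ) • (x + y)) / γ) 1 with h1 | h1
      · rw [min_eq_left h1]; exact hdiv _ _ _ (h x y)
      · rw [min_eq_right h1, one_pow]; exact mul_le_one' (hFα x) (hGβ y))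
  have hlt : ∀ {z : ℝ≥0∞}, z ≤ 1 → z ≠ ⊤ := fun hz => ne_top_of_le_ne_top ENNReal.one_ne_top hz
  simp_rw [ENNReal.ofReal_toReal (hmin _), ENNReal.ofReal_toReal (hlt (hFα _)),
    ENNReal.ofReal_toReal (hlt (hGβ _))] at key
  have key2 : (∫⁻ x, F x) / α + (∫⁻ x, G x) / β ≤ 2 * ((∫⁻ x, H x) / γ) := by
    simp only [div_eq_mul_inv] at key ⊢
    rw [lintegral_mul_const _ hF, lintegral_mul_const _ hG] at key
    rw [← lintegral_mul_const _ hH]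
    refine key.trans ?_
    gcongr
    exact min_le_left _ _
  have key3 := (ENNReal.four_mul_mul_le_add_sq _ _).trans (pow_le_pow_left' key2 2)
  rw [mul_pow, show (2 : ℝ≥0∞) ^ 2 = 4 by norm_num,
    ENNReal.mul_le_mul_iff_right (by norm_num) (by norm_num)] at key3
  simp only [div_eq_mul_inv] at key3
  rw [mul_mul_mul_comm, ← ENNReal.mul_inv (.inl hα0) (.inl hFt), mul_pow, ← ENNReal.inv_pow,
    hγ2] at key3
  exact (ENNReal.mul_le_mul_iff_left (ENNReal.inv_ne_zero.2 hαβt) (ENNReal.inv_ne_top.2 hαβ0)).1 key3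

theorem lintegral_eq_iSup_lintegral_min {F : ℝ → ℝ≥0∞} (hF : Measurable F) :
    ∫⁻ x, F x = ⨆ n : ℕ, ∫⁻ x, min (F x) n := by
  rw [← lintegral_iSup (fun n => by fun_prop)
    (fun m n hmn x => by dsimp only; gcongr)]
  refine lintegral_congr fun x => ?_
  have := inf_iSup_eq (F x) (fun n : ℕ => (n : ℝ≥0∞))
  rw [ENNReal.iSup_natCast, inf_top_eq] at this
  exact this

/-- The one-dimensional Prékopa–Leindler inequality. -/
theorem prekopaLeindler_real : PrekopaLeindler ℝ := by
  intro F G H hF hG hH h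
  -- Truncating F and G preserves the hypothesis, so monotone convergence reduces to bounded
  -- functions.
  rw [lintegral_eq_iSup_lintegral_min hF, lintegral_eq_iSup_lintegral_min hG, ENNReal.iSup_mul]
  refine iSup_le fun m => ?_
  rw [ENNReal.mul_iSup]
  refine iSup_le fun n => ?_
  refine lintegral_mul_lintegral_le_of_bounded (by fun_prop) (by fun_prop) hH
    (ne_top_of_le_ne_top (ENNReal.natCast_ne_top m) (iSup_le fun x => min_le_right _ _))
    (ne_top_of_le_ne_top (ENNReal.natCast_ne_top n) (iSup_le fun x => min_le_right _ _))
    fun x y => (mul_le_mul' (min_le_left _ _) (min_le_left _ _)).trans (h x y)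

/-- The inequality on `E'`, applied to slices, is exactly the hypothesis on `E` for the marginals.
-/
theorem PrekopaLeindler.prod {E E' : Type*} [AddCommGroup E] [Module ℝ E] [MeasureSpace E]
    [AddCommGroup E'] [Module ℝ E'] [MeasureSpace E'] [SFinite (volume : Measure E')]
    (hE : PrekopaLeindler E) (hE' : PrekopaLeindler E') [SFinite (volume : Measure E)] :
    PrekopaLeindler (E × E') := by
  intro F G H hF hG hH h
  rw [Measure.volume_eq_prod, lintegral_prod _ hF.aemeasurable, lintegral_prod _ hG.aemeasurable,
    lintegral_prod _ hH.aemeasurable]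
  refine hE _ _ _ hF.lintegral_prod_right' hG.lintegral_prod_right' hH.lintegral_prod_right' ?_
  intro x y
  exact hE' _ _ _ (by fun_prop) (by fun_prop) (by fun_prop) fun u v => h (x, u) (y, v)

theorem PrekopaLeindler.of_measurePreserving {E E' : Type*} [AddCommGroup E] [Module ℝ E]
    [MeasureSpace E] [AddCommGroup E'] [Module ℝ E'] [MeasureSpace E'] {T : E → E'}
    (hT : MeasurePreserving T)
    (hmid : ∀ x y, T ((1 / 2 : ℝ) • (x + y)) = (1 / 2 : ℝ) • (T x + T y))
    (hE : PrekopaLeindler E) : PrekopaLeindler E' := by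
  intro F G H hF hG hH h
  rw [← hT.lintegral_comp hF, ← hT.lintegral_comp hG, ← hT.lintegral_comp hH]
  refine hE _ _ _ (hF.comp hT.measurable) (hG.comp hT.measurable) (hH.comp hT.measurable) ?_
  intro x y
  rw [hmid]
  exact h _ _

theorem prekopaLeindler_pi (n : ℕ) : PrekopaLeindler (Fin n → ℝ) := by
  induction n with
  | zero =>
    intro F G H _ _ _ h
    have := h default default
    rw [Subsingleton.elim ((1 / 2 : ℝ) • ((default : Fin 0 → ℝ) + default)) default] at this
    simpa [volume_pi, Measure.pi_of_empty _ default] using this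
  | succ n ih =>
    refine (prekopaLeindler_real.prod ih).of_measurePreserving
      (volume_preserving_piFinSuccAbove (fun _ : Fin (n + 1) => ℝ) 0).symm fun x y => ?_
    ext i
    refine Fin.cases ?_ (fun j => ?_) i <;> simp [MeasurableEquiv.piFinSuccAbove, mul_add]

/-- The Prékopa–Leindler inequality on Euclidean space. -/
theorem prekopaLeindler_euclideanSpace (n : ℕ) : PrekopaLeindler (EuclideanSpace ℝ (Fin n)) :=
  (prekopaLeindler_pi n).of_measurePreserving (PiLp.volume_preserving_toLp (Fin n))
    fun _ _ => rfl

/-! ### Quadratic bounds and convexity of the potential -/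

namespace IsSmoothStronglyConvex

variable {d : ℕ} {μ L : ℝ} {f : EuclideanSpace ℝ (Fin d) → ℝ}

theorem lower_bound (hf : IsSmoothStronglyConvex μ L f) (x y : EuclideanSpace ℝ (Fin d)) :
    f x + inner ℝ (gradient f x) (y - x) + μ / 2 * ‖x - y‖ ^ 2 ≤ f y := by
  rcases eq_or_ne x y with rfl | hxy
  · simp
  · have hpos : 0 < ‖x - y‖ ^ 2 / 2 := by
      have := norm_pos_iff.2 (sub_ne_zero.2 hxy)
      positivity
    have := (le_div_iff₀ hpos).1 (hf.2 x y hxy).1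
    linarith

theorem upper_bound (hf : IsSmoothStronglyConvex μ L f) (x y : EuclideanSpace ℝ (Fin d)) :
    f y ≤ f x + inner ℝ (gradient f x) (y - x) + L / 2 * ‖x - y‖ ^ 2 := by
  rcases eq_or_ne x y with rfl | hxy
  · simp
  · have hpos : 0 < ‖x - y‖ ^ 2 / 2 := by
      have := norm_pos_iff.2 (sub_ne_zero.2 hxy)
      positivity
    have := (div_le_iff₀ hpos).1 (hf.2 x y hxy).2
    linarith

theorem gradient_zero (hmin : ∀ x, f 0 ≤ f x) : gradient f 0 = 0 := by
  have : IsLocalMin f 0 := Filter.Eventually.of_forall hmin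
  simp [gradient, this.fderiv_eq_zero]

theorem quadratic_le (hf : IsSmoothStronglyConvex μ L f) (hmin : ∀ x, f 0 ≤ f x)
    (x : EuclideanSpace ℝ (Fin d)) : f 0 + μ / 2 * ‖x‖ ^ 2 ≤ f x := by
  simpa [gradient_zero hmin] using hf.lower_bound 0 x

theorem le_quadratic (hf : IsSmoothStronglyConvex μ L f) (hmin : ∀ x, f 0 ≤ f x)
    (x : EuclideanSpace ℝ (Fin d)) : f x ≤ f 0 + L / 2 * ‖x‖ ^ 2 := by
  simpa [gradient_zero hmin] using hf.upper_bound 0 x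

/-- The convex function `f - μ‖·‖²/2`, minimal at `0`, at a contracted midpoint. -/
theorem sub_quadratic_smul_add_le (hf : IsSmoothStronglyConvex μ L f) (hmin : ∀ x, f 0 ≤ f x)
    {α : ℝ} (hα0 : 0 ≤ α) (hα : α ≤ 1 / 2) (x y : EuclideanSpace ℝ (Fin d)) :
    2 * (f (α • (x + y)) - μ / 2 * ‖α • (x + y)‖ ^ 2) ≤
      (f x - μ / 2 * ‖x‖ ^ 2) + (f y - μ / 2 * ‖y‖ ^ 2) := by
  set m := α • (x + y) with hm
  have hx := hf.lower_bound m x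
  have hy := hf.lower_bound m y
  have h0 := hf.lower_bound m 0
  have hx0 := hf.quadratic_le hmin x
  have hy0 := hf.quadratic_le hmin y
  have e1 : α * (inner ℝ (gradient f m) x + inner ℝ (gradient f m) y) =
      inner ℝ (gradient f m) m := by
    conv_rhs => rw [hm]
    rw [inner_smul_right, inner_add_right]
  have e2 : α * (inner ℝ m x + inner ℝ m y) = ‖m‖ ^ 2 := by
    rw [← real_inner_self_eq_norm_sq]
    conv_rhs => rw [hm, inner_smul_right, inner_add_right, ← hm]
  rw [norm_sub_sq_real, inner_sub_right] at hx hy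
  simp only [zero_sub, sub_zero, inner_neg_right] at h0
  -- m is the barycentre of x, y, 0 with weights α, α, 1 - 2α, so the gradient terms cancel. The
  -- leftover value at 0 is absorbed in `h4` by minimality at 0.
  have h1 := mul_le_mul_of_nonneg_left hx hα0
  have h2 := mul_le_mul_of_nonneg_left hy hα0
  have h3 := mul_le_mul_of_nonneg_left h0 (show 0 ≤ 1 - 2 * α by linarith)
  have h4 := mul_le_mul_of_nonneg_left (add_le_add hx0 hy0) (show 0 ≤ 1 / 2 - α by linarith)
  linear_combination 2 * (h1 + h2 + h3 + h4) - 2 * e1 + 2 * μ * e2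

end IsSmoothStronglyConvex

/-! ### Partition functions -/

theorem integrable_exp_neg_mul_sq_norm (d : ℕ) {b : ℝ} (hb : 0 < b) :
    Integrable fun x : EuclideanSpace ℝ (Fin d) => Real.exp (-b * ‖x‖ ^ 2) := by
  refine Integrable.of_integral_ne_zero ?_
  rw [GaussianFourier.integral_rexp_neg_mul_sq_norm hb]
  positivity

/-- The normalizing constant of the density proportional to `exp (-(f + t‖·‖²/2))`. -/
noncomputable def partitionFunction {d : ℕ} (f : EuclideanSpace ℝ (Fin d) → ℝ) (t : ℝ) : ℝ :=
  ∫ x, Real.exp (-(f x + t / 2 * ‖x‖ ^ 2))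

theorem IsSmoothStronglyConvex.integrable_exp_neg {d : ℕ} {μ L : ℝ}
    {f : EuclideanSpace ℝ (Fin d) → ℝ} (hf : IsSmoothStronglyConvex μ L f)
    (hmin : ∀ x, f 0 ≤ f x) (hμ : 0 < μ) {t : ℝ} (ht : 0 ≤ t) :
    Integrable fun x => Real.exp (-(f x + t / 2 * ‖x‖ ^ 2)) := by
  have hc : Continuous f := hf.1.continuous
  refine ((integrable_exp_neg_mul_sq_norm d (half_pos hμ)).const_mul
    (Real.exp (-f 0))).mono' (by fun_prop) (.of_forall fun x => ?_)
  rw [Real.norm_eq_abs, Real.abs_exp, ← Real.exp_add, Real.exp_le_exp]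
  have := hf.quadratic_le hmin x
  have : 0 ≤ t / 2 * ‖x‖ ^ 2 := by positivity
  linarith

/-- Bounds the Jacobian of the contraction: 4ab/(a+b)² = (1 + (a-b)²/(4ab))⁻¹, then ab ≥ b² and 1 +
u ≤ exp u. -/
theorem exp_neg_le_two_mul_sqrt_div_pow {d : ℕ} (hd : 1 ≤ d) {a b K : ℝ} (hb : 0 < b) (hab : b ≤ a)
    (hK : d * (a - b) ^ 2 ≤ K * b ^ 2) :
    Real.exp (-K / 8) ≤ (2 * (Real.sqrt (a * b) / (a + b))) ^ d := by
  have ha : 0 < a := hb.trans_le hab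
  have hd' : (0 : ℝ) < d := by exact_mod_cast hd
  refine le_of_pow_le_pow_left₀ two_ne_zero (by positivity) ?_
  have hsq : (2 * (Real.sqrt (a * b) / (a + b))) ^ 2 = (1 + (a - b) ^ 2 / (4 * (a * b)))⁻¹ := by
    rw [mul_pow, div_pow, Real.sq_sqrt (by positivity)]
    have : 1 + (a - b) ^ 2 / (4 * (a * b)) = (a + b) ^ 2 / (4 * (a * b)) := by
      field_simp; ring
    rw [this, inv_div]; ring
  have hq : (a - b) ^ 2 / (4 * (a * b)) ≤ K / (4 * d) := by
    rw [div_le_div_iff₀ (by positivity) (by positivity)]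
    have hK0 : 0 ≤ K := by
      have : 0 ≤ K * b ^ 2 := le_trans (by positivity) hK
      exact nonneg_of_mul_nonneg_left this (by positivity)
    nlinarith [mul_le_mul_of_nonneg_left (mul_le_mul_of_nonneg_right hab hb.le) hK0]
  rw [← pow_mul, mul_comm d 2, pow_mul, hsq]
  calc Real.exp (-K / 8) ^ 2 = ((Real.exp (K / (4 * d)))⁻¹) ^ d := by
        rw [← Real.exp_neg, ← Real.exp_nat_mul, ← Real.exp_nat_mul]
        congr 1
        push_cast
        field_simp
        ring
    _ ≤ _ := by
        gcongr
        rw [add_comm]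
        exact (add_le_add_left hq 1).trans (Real.add_one_le_exp _)

/-- An approximate midpoint log-concavity of the partition function in the strength of the
quadratic confinement. -/
theorem IsSmoothStronglyConvex.exp_mul_sqrt_partitionFunction_le {d : ℕ} (hd : 1 ≤ d) {μ L : ℝ}
    {f : EuclideanSpace ℝ (Fin d) → ℝ} (hf : IsSmoothStronglyConvex μ L f)
    (hmin : ∀ x, f 0 ≤ f x) (hμ : 0 < μ) {a b K : ℝ} (hb : 0 ≤ b) (hab : b ≤ a)
    (hK : d * (a - b) ^ 2 ≤ K * (b + μ) ^ 2) :
    Real.exp (-K / 8) * Real.sqrt (partitionFunction f a * partitionFunction f b) ≤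
      partitionFunction f ((a + b) / 2) := by
  have hc : Continuous f := hf.1.continuous
  have hb' : 0 < b + μ := by positivity
  have ha' : 0 < a + μ := by linarith
  -- The largest factor for which `h2` below can hold for all x, y: for fixed x + y = z, the minimum
  -- of A‖x‖² + B‖y‖² is AB/(A+B)·‖z‖².
  set α := Real.sqrt ((a + μ) * (b + μ)) / ((a + μ) + (b + μ)) with hα
  have hα0 : 0 < α := by positivity
  have hα2 : α ^ 2 * ((a + μ) + (b + μ)) ^ 2 = (a + μ) * (b + μ) := by
    rw [hα, div_pow, Real.sq_sqrt (by positivity)]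
    field_simp
  have hαle : α ≤ 1 / 2 := by
    refine le_of_pow_le_pow_left₀ two_ne_zero (by norm_num) ?_
    have : 0 < ((a + μ) + (b + μ)) ^ 2 := by positivity
    refine le_of_mul_le_mul_right ?_ this
    rw [hα2]
    nlinarith [sq_nonneg (a - b)]
  set t := (a + b) / 2 with ht
  set H : EuclideanSpace ℝ (Fin d) → ℝ := fun x => Real.exp (-(f x + t / 2 * ‖x‖ ^ 2)) with hH
  have hHi : Integrable H := hf.integrable_exp_neg hmin hμ (by linarith)
  have hHi' : Integrable fun x => H ((2 * α) • x) := hHi.comp_smul (by positivity)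
  have key : partitionFunction f a * partitionFunction f b ≤ (∫ x, H ((2 * α) • x)) ^ 2 := by
    have hpl := prekopaLeindler_euclideanSpace d
      (fun x => ENNReal.ofReal (Real.exp (-(f x + a / 2 * ‖x‖ ^ 2))))
      (fun x => ENNReal.ofReal (Real.exp (-(f x + b / 2 * ‖x‖ ^ 2))))
      (fun x => ENNReal.ofReal (H ((2 * α) • x))) (by fun_prop) (by fun_prop) (by fun_prop) (by
        intro x y
        rw [← ENNReal.ofReal_mul (by positivity), ← ENNReal.ofReal_pow (by positivity), smul_smul,
          show 2 * α * (1 / 2) = α by ring, ← Real.exp_add, ← Real.exp_nat_mul]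
        refine ENNReal.ofReal_le_ofReal (Real.exp_le_exp.2 ?_)
        have h1 := hf.sub_quadratic_smul_add_le hmin hα0.le hαle x y
        have h2 : ((a + μ) + (b + μ)) * ‖α • (x + y)‖ ^ 2 ≤
            (a + μ) * ‖x‖ ^ 2 + (b + μ) * ‖y‖ ^ 2 := by
          have hs : 0 < (a + μ) + (b + μ) := by positivity
          refine le_of_mul_le_mul_left ?_ hs
          -- This square is (A+B)(A‖x‖² + B‖y‖²) - AB‖x+y‖², with A = a+μ, B = b+μ.
          have h3 : 0 ≤ ‖(a + μ) • x - (b + μ) • y‖ ^ 2 := sq_nonneg _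
          rw [norm_sub_sq_real, norm_smul, norm_smul, inner_smul_left, inner_smul_right, mul_pow,
            mul_pow, Real.norm_eq_abs, Real.norm_eq_abs, sq_abs, sq_abs] at h3
          simp only [conj_trivial] at h3
          rw [norm_smul, mul_pow, Real.norm_eq_abs, sq_abs, norm_add_sq_real]
          linear_combination h3 + (‖x‖ ^ 2 + 2 * inner ℝ x y + ‖y‖ ^ 2) * hα2
        rw [ht]
        push_cast
        linear_combination h1 + h2 / 2)
    have hexp : ∀ g : EuclideanSpace ℝ (Fin d) → ℝ, 0 ≤ᵐ[volume] fun x => Real.exp (g x) :=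
      fun g => .of_forall fun x => (Real.exp_pos _).le
    rw [← ofReal_integral_eq_lintegral_ofReal (hf.integrable_exp_neg hmin hμ (hb.trans hab))
        (hexp _),
      ← ofReal_integral_eq_lintegral_ofReal (hf.integrable_exp_neg hmin hμ hb) (hexp _),
      ← ofReal_integral_eq_lintegral_ofReal hHi' (hexp _),
      ← ENNReal.ofReal_mul (integral_nonneg fun x => (Real.exp_pos _).le),
      ← ENNReal.ofReal_pow (integral_nonneg fun x => (Real.exp_pos _).le),
      ENNReal.ofReal_le_ofReal_iff (by positivity)] at hpl
    exact hpl
  rw [Measure.integral_comp_smul_of_nonneg _ _ _ (hR := by positivity), finrank_euclideanSpace,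
    Fintype.card_fin, smul_eq_mul] at key
  have hZ : 0 ≤ ∫ x, H x := integral_nonneg fun x => (Real.exp_pos _).le
  have hpow : 0 < (2 * α) ^ d := by positivity
  calc Real.exp (-K / 8) * Real.sqrt (partitionFunction f a * partitionFunction f b)
      ≤ (2 * α) ^ d * (((2 * α) ^ d)⁻¹ * ∫ x, H x) := by
        refine mul_le_mul ?_ ?_ (Real.sqrt_nonneg _) hpow.le
        · exact exp_neg_le_two_mul_sqrt_div_pow hd hb' (by linarith) (by simpa using hK)
        · exact (Real.sqrt_le_sqrt key).trans_eq (Real.sqrt_sq (by positivity))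
    _ = ∫ x, H x := mul_inv_cancel_left₀ hpow.ne' _

/-! ### Overlaps of qsample states -/

theorem memLp_sqrt_density {d : ℕ} {u : EuclideanSpace ℝ (Fin d) → ℝ} (hu : Continuous u)
    (hi : Integrable fun x => Real.exp (-u x)) {Z : ℝ} (hZ : 0 ≤ Z) :
    MemLp (fun x => ((Real.sqrt (Z * Real.exp (-u x)) : ℝ) : ℂ)) 2 volume := by
  refine MemLp.ofReal ?_
  rw [memLp_two_iff_integrable_sq (by fun_prop)]
  refine (hi.const_mul Z).congr (.of_forall fun x => ?_)
  exact (Real.sq_sqrt (by positivity)).symm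

/-- The overlap of two qsample states of Gibbs densities, bounded below by partition functions. -/
theorem le_norm_inner_qsample {d : ℕ} {u v : EuclideanSpace ℝ (Fin d) → ℝ} (hu : Continuous u)
    (hv : Continuous v) (hiu : Integrable fun x => Real.exp (-u x))
    (hiv : Integrable fun x => Real.exp (-v x)) {q : ℝ}
    (h : q * Real.sqrt ((∫ x, Real.exp (-u x)) * ∫ x, Real.exp (-v x)) ≤
      ∫ x, Real.exp (-((u x + v x) / 2))) :
    q ≤ ‖inner ℂ (qsample fun x => (∫ y, Real.exp (-u y))⁻¹ * Real.exp (-u x))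
      (qsample fun x => (∫ y, Real.exp (-v y))⁻¹ * Real.exp (-v x))‖ := by
  have hZu : 0 < ∫ x, Real.exp (-u x) := integral_exp_pos hiu
  have hZv : 0 < ∫ x, Real.exp (-v x) := integral_exp_pos hiv
  set Zu := ∫ x, Real.exp (-u x)
  set Zv := ∫ x, Real.exp (-v x)
  have hmu := memLp_sqrt_density hu hiu (inv_nonneg.2 hZu.le)
  have hmv := memLp_sqrt_density hv hiv (inv_nonneg.2 hZv.le)
  have hsqrt : ∀ x, Real.sqrt (Zu⁻¹ * Real.exp (-u x)) * Real.sqrt (Zv⁻¹ * Real.exp (-v x)) =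
      (Real.sqrt (Zu * Zv))⁻¹ * Real.exp (-((u x + v x) / 2)) := by
    intro x
    rw [← Real.sqrt_mul (by positivity), mul_mul_mul_comm, ← mul_inv, ← Real.exp_add,
      Real.sqrt_mul (by positivity), Real.sqrt_inv]
    congr 1
    rw [← Real.exp_half]
    congr 1
    ring
  have hinner : inner ℂ (qsample fun x => Zu⁻¹ * Real.exp (-u x))
      (qsample fun x => Zv⁻¹ * Real.exp (-v x)) =
      (((Real.sqrt (Zu * Zv))⁻¹ * ∫ x, Real.exp (-((u x + v x) / 2)) : ℝ) : ℂ) := by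
    rw [qsample, qsample, dif_pos hmu, dif_pos hmv, L2.inner_def, ← integral_const_mul,
      ← integral_complex_ofReal]
    refine integral_congr_ae ?_
    filter_upwards [hmu.coeFn_toLp, hmv.coeFn_toLp] with x hx hy
    rw [hx, hy, ← hsqrt]
    simp [mul_comm]
  rw [hinner, Complex.norm_real]
  refine le_trans ?_ (le_abs_self _)
  rw [inv_mul_eq_div, le_div_iff₀ (by positivity)]
  exact h

/-- The explicit Gaussian constant is the inverse of its own integral, so i = 0 needs no separate
normalization. -/
theorem annealDensity_eq {d : ℕ} (f : EuclideanSpace ℝ (Fin d) → ℝ) {σ : ℕ → ℝ}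
    (hσ : 0 < σ 1 ^ 2) (M i : ℕ) :
    annealDensity f σ M i = fun x => (∫ y, Real.exp (-annealPotential f σ M i y))⁻¹ *
      Real.exp (-annealPotential f σ M i x) := by
  ext x
  rcases eq_or_ne i 0 with rfl | hi
  · have : ∀ y, -annealPotential f σ M 0 y = -(1 / (2 * σ 1 ^ 2)) * ‖y‖ ^ 2 := fun y => by
      simp only [annealPotential, if_true]; ring
    simp only [annealDensity, if_true, this]
    rw [GaussianFourier.integral_rexp_neg_mul_sq_norm (by positivity), finrank_euclideanSpace,
      Fintype.card_fin, ← Real.rpow_neg (by positivity)]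
    congr 2
    · field_simp
    · ring
  · simp [annealDensity, hi]

/-- A Gaussian and its perturbation by `f` have a large overlap if the Gaussian is narrow enough. -/
theorem IsSmoothStronglyConvex.exp_mul_sqrt_gaussian_le {d : ℕ} (hd : 1 ≤ d) {μ L s : ℝ}
    {f : EuclideanSpace ℝ (Fin d) → ℝ} (hf : IsSmoothStronglyConvex μ L f)
    (hmin : ∀ x, f 0 ≤ f x) (hμ : 0 < μ) (hL : 0 < L) (hs : 0 < s) (hLs : 2 * d * L ≤ s) :
    Real.exp (-1 / 8) * Real.sqrt ((∫ x : EuclideanSpace ℝ (Fin d), Real.exp (-(s / 2 * ‖x‖ ^ 2))) *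
        partitionFunction f s) ≤
      ∫ x, Real.exp (-((s / 2 * ‖x‖ ^ 2 + (f x + s / 2 * ‖x‖ ^ 2)) / 2)) := by
  have hc : Continuous f := hf.1.continuous
  have hd' : (0 : ℝ) < d := by exact_mod_cast hd
  have hg : ∀ b : ℝ, 0 < b → ∫ x : EuclideanSpace ℝ (Fin d), Real.exp (-(b * ‖x‖ ^ 2)) =
      (Real.pi / b) ^ ((d : ℝ) / 2) := fun b hb => by
    simpa using GaussianFourier.integral_rexp_neg_mul_sq_norm (V := EuclideanSpace ℝ (Fin d)) hb
  have hgi : ∀ b : ℝ, 0 < b →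
      Integrable fun x : EuclideanSpace ℝ (Fin d) => Real.exp (-(b * ‖x‖ ^ 2)) := fun b hb => by
    simpa using integrable_exp_neg_mul_sq_norm d hb
  have hs2 : 0 < s / 2 := half_pos hs
  have hb : 0 < s / 2 + L / 4 := by positivity
  set Z := ∫ x : EuclideanSpace ℝ (Fin d), Real.exp (-(s / 2 * ‖x‖ ^ 2)) with hZ
  have hZ0 : 0 ≤ Z := integral_nonneg fun x => (Real.exp_pos _).le
  have h1 : partitionFunction f s ≤ Real.exp (-f 0) * Z := by
    rw [hZ, ← integral_const_mul]
    refine integral_mono (hf.integrable_exp_neg hmin hμ hs.le) ((hgi _ hs2).const_mul _) fun x => ?_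
    dsimp only
    rw [← Real.exp_add, Real.exp_le_exp]
    linarith [hmin x]
  have h2 : Real.exp (-f 0 / 2) * ∫ x : EuclideanSpace ℝ (Fin d),
      Real.exp (-((s / 2 + L / 4) * ‖x‖ ^ 2)) ≤
      ∫ x, Real.exp (-((s / 2 * ‖x‖ ^ 2 + (f x + s / 2 * ‖x‖ ^ 2)) / 2)) := by
    rw [← integral_const_mul]
    refine integral_mono ((hgi _ hb).const_mul _) ?_ fun x => ?_
    · refine ((hgi _ hs2).const_mul (Real.exp (-f 0 / 2))).mono' (by fun_prop)
        (.of_forall fun x => ?_)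
      rw [Real.norm_eq_abs, Real.abs_exp, ← Real.exp_add, Real.exp_le_exp]
      linarith [hmin x]
    · dsimp only
      rw [← Real.exp_add, Real.exp_le_exp]
      linarith [hf.le_quadratic hmin x]
  have h3 : Real.exp (-1 / 8) * Z ≤
      ∫ x : EuclideanSpace ℝ (Fin d), Real.exp (-((s / 2 + L / 4) * ‖x‖ ^ 2)) := by
    rw [hZ, hg _ hs2, hg _ hb]
    have hr : L / (2 * s) ≤ 1 / (4 * d) := by
      rw [div_le_div_iff₀ (by positivity) (by positivity)]
      linarith
    -- The ratio is 1 + L/(2s) ≤ exp(1/(4d)); its power d/2 gives the constant exp(1/8).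
    have hfac : Real.pi / (s / 2) ≤ Real.exp (1 / (4 * d)) * (Real.pi / (s / 2 + L / 4)) := by
      have e : Real.pi / (s / 2) = (L / (2 * s) + 1) * (Real.pi / (s / 2 + L / 4)) := by
        field_simp
        ring
      rw [e]
      gcongr
      exact (add_le_add_left hr 1).trans (Real.add_one_le_exp _)
    calc Real.exp (-1 / 8) * (Real.pi / (s / 2)) ^ ((d : ℝ) / 2)
        ≤ Real.exp (-1 / 8) *
          (Real.exp (1 / (4 * d)) * (Real.pi / (s / 2 + L / 4))) ^ ((d : ℝ) / 2) := by
          gcongr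
      _ = (Real.pi / (s / 2 + L / 4)) ^ ((d : ℝ) / 2) := by
          rw [Real.mul_rpow (by positivity) (by positivity), ← Real.exp_mul, ← mul_assoc,
            ← Real.exp_add]
          have : -1 / 8 + 1 / (4 * (d : ℝ)) * (d / 2) = 0 := by field_simp; norm_num
          rw [this, Real.exp_zero, one_mul]
  have h4 : Real.sqrt (Z * partitionFunction f s) ≤ Real.exp (-f 0 / 2) * Z := by
    refine Real.sqrt_le_iff.2 ⟨by positivity, ?_⟩
    rw [mul_pow, ← Real.exp_nat_mul, show ((2 : ℕ) : ℝ) * (-f 0 / 2) = -f 0 by push_cast; ring]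
    linarith [mul_le_mul_of_nonneg_left h1 hZ0]
  refine le_trans ?_ ((mul_le_mul_of_nonneg_left h3 (Real.exp_pos _).le).trans h2)
  calc _ ≤ Real.exp (-1 / 8) * (Real.exp (-f 0 / 2) * Z) := by gcongr
    _ = _ := by ring

/-- The overlap of the qsample states for two strengths `b ≤ a` of the quadratic confinement. -/
theorem IsSmoothStronglyConvex.le_norm_inner_qsample {d : ℕ} (hd : 1 ≤ d) {μ L : ℝ}
    {f : EuclideanSpace ℝ (Fin d) → ℝ} (hf : IsSmoothStronglyConvex μ L f)
    (hmin : ∀ x, f 0 ≤ f x) (hμ : 0 < μ) {a b K : ℝ} (hb : 0 ≤ b) (hab : b ≤ a)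
    (hK : d * (a - b) ^ 2 ≤ K * (b + μ) ^ 2) :
    Real.exp (-K / 8) ≤
      ‖inner ℂ (qsample fun x => (∫ y, Real.exp (-(f y + a / 2 * ‖y‖ ^ 2)))⁻¹ *
          Real.exp (-(f x + a / 2 * ‖x‖ ^ 2)))
        (qsample fun x => (∫ y, Real.exp (-(f y + b / 2 * ‖y‖ ^ 2)))⁻¹ *
          Real.exp (-(f x + b / 2 * ‖x‖ ^ 2)))‖ := by
  have hc : Continuous f := hf.1.continuous
  refine _root_.le_norm_inner_qsample (by fun_prop) (by fun_prop)
    (hf.integrable_exp_neg hmin hμ (hb.trans hab)) (hf.integrable_exp_neg hmin hμ hb) ?_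
  refine (hf.exp_mul_sqrt_partitionFunction_le hd hmin hμ hb hab hK).trans_eq ?_
  refine integral_congr_ae (.of_forall fun x => ?_)
  dsimp only
  congr 1
  ring

theorem mainTheorem10 (c : ℝ) (hc : 0 < c) :
    ∃ p : ℝ, 0 < p ∧
      ∀ (d : ℕ) (_ : 1 ≤ d) (μ L ε : ℝ) (_ : 0 < μ) (_ : 0 < L) (_ : 0 < ε) (_ : ε < 1)
        (f : EuclideanSpace ℝ (Fin d) → ℝ) (_ : IsSmoothStronglyConvex μ L f)
        (_ : ∀ x, f 0 ≤ f x)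
        (M : ℕ) (_ : 1 ≤ M) (σ : ℕ → ℝ)
        (_ : σ 1 ^ 2 = ε / (2 * d * L))
        (_ : ∀ i, 1 ≤ i → i < M → σ (i + 1) ^ 2 = (1 + 1 / Real.sqrt d) * σ i ^ 2)
        (_ : c * (Real.sqrt d / μ) ≤ σ M ^ 2),
        ∀ i, i ≤ M →
          p ≤ ‖inner ℂ (qsample (annealDensity f σ M i))
                (qsample (annealDensity f σ M (i + 1)))‖ := by
  -- The sum 1 + 1/c² dominates both values of K, namely 1 and 1/c²; the first step also gives
  -- exp(-1/8).
  refine ⟨Real.exp (-(1 + 1 / c ^ 2) / 8), Real.exp_pos _, ?_⟩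
  intro d hd μ L ε hμ hL hε hε1 f hf hmin M hM σ hσ1 hσ hσM i hi
  have hc0 : Continuous f := hf.1.continuous
  have hd' : (0 : ℝ) < d := by exact_mod_cast hd
  have hpos : 0 < σ 1 ^ 2 := by rw [hσ1]; positivity
  have hσpos : ∀ j, 1 ≤ j → j ≤ M → 0 < σ j ^ 2 := by
    intro j hj
    induction j, hj using Nat.le_induction with
    | base => exact fun _ => hpos
    | succ j hj ih =>
      intro hjM
      rw [hσ j hj hjM]
      have := ih (by omega)
      positivity
  have hmid : ∀ j, 1 ≤ j → j ≤ M → annealPotential f σ M j =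
      fun x => f x + 1 / σ j ^ 2 / 2 * ‖x‖ ^ 2 := by
    intro j hj hjM
    ext x
    rw [annealPotential, if_neg (by omega), if_pos hjM]
    ring
  have hlast : annealPotential f σ M (M + 1) = fun x => f x + 0 / 2 * ‖x‖ ^ 2 := by
    ext x
    simp [annealPotential]
  have hc2 : 0 < 1 / c ^ 2 := by positivity
  rw [annealDensity_eq f hpos, annealDensity_eq f hpos]
  rcases Nat.eq_zero_or_pos i with rfl | hi0
  · have hzero : annealPotential f σ M 0 = fun x => 1 / σ 1 ^ 2 / 2 * ‖x‖ ^ 2 := by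
      ext x
      simp only [annealPotential, if_true]
      ring
    rw [zero_add, hzero, hmid 1 le_rfl hM]
    have hs : 0 < 1 / σ 1 ^ 2 := by positivity
    refine le_trans (Real.exp_le_exp.2 (by linarith : -(1 + 1 / c ^ 2) / 8 ≤ -1 / 8))
      (le_norm_inner_qsample (by fun_prop) (by fun_prop) ?_
        (hf.integrable_exp_neg hmin hμ hs.le)
        (hf.exp_mul_sqrt_gaussian_le hd hmin hμ hL hs ?_))
    · simpa using integrable_exp_neg_mul_sq_norm d (half_pos hs)
    · rw [hσ1, one_div_div, le_div_iff₀ hε]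
      exact mul_le_of_le_one_right (by positivity) hε1.le
  · rcases hi.eq_or_lt with rfl | hiM
    · rw [hlast, hmid i hi0 le_rfl]
      have hsi := hσpos i hi0 le_rfl
      refine le_trans (Real.exp_le_exp.2 (by linarith : -(1 + 1 / c ^ 2) / 8 ≤ -(1 / c ^ 2) / 8))
        (hf.le_norm_inner_qsample hd hmin hμ le_rfl (by positivity) ?_)
      have h1 : c * Real.sqrt d ≤ σ i ^ 2 * μ := by
        rwa [← mul_div_assoc, div_le_iff₀ hμ] at hσM
      have h2 := pow_le_pow_left₀ (by positivity) h1 2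
      rw [mul_pow, Real.sq_sqrt hd'.le] at h2
      rw [sub_zero, zero_add, div_pow, one_pow, mul_one_div, one_div_mul_eq_div,
        div_le_div_iff₀ (by positivity) (by positivity)]
      linarith
    · rw [hmid i hi0 hi, hmid (i + 1) (by omega) hiM]
      have hsi := hσpos i hi0 hi
      rw [hσ i hi0 hiM]
      have hsd : 0 < Real.sqrt d := Real.sqrt_pos.2 hd'
      have hr : 0 < 1 + 1 / Real.sqrt d := by positivity
      -- b = 1/σ_{i+1}², so d(a-b)² = b² ≤ (b+μ)² and K = 1.
      set b := 1 / ((1 + 1 / Real.sqrt d) * σ i ^ 2) with hb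
      have hb0 : 0 < b := by positivity
      have ha : 1 / σ i ^ 2 = b + b / Real.sqrt d := by
        rw [hb]; field_simp
      rw [ha]
      refine le_trans (Real.exp_le_exp.2 (by linarith : -(1 + 1 / c ^ 2) / 8 ≤ -1 / 8))
        (hf.le_norm_inner_qsample hd hmin hμ hb0.le
          (le_add_of_nonneg_right (by positivity)) ?_)
      rw [add_sub_cancel_left, div_pow, Real.sq_sqrt hd'.le, mul_div_cancel₀ _ hd'.ne', one_mul]
      gcongr
      linarith
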